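/- Let $\alpha\in(0,1)$ and $b>0$. Let $\mathbf X$ be a random vector with values in $[-b,b]^n$ and $Y$ a random variable with values in a countable set $\mathcal Y$. Their joint distribution depends on a parameter $\theta\in\mathbb R^k$: $Y$ has probability mass function $f_Y(y;\theta)$, and given $Y=y$ the vector $\mathbf X$ has a density $f_{\mathbf X|Y}(\mathbf x|y;\theta)$ on $[-b,b]^n$. Let $r:[-b,b]^n\times\mathcal Y\to\mathbb R$ be bounded (and measurable), and $R=r(\mathbf X,Y)$. Put $\nu_\alpha(R;\theta)=\inf\{z:\Pr^\theta(R\le z)\ge\alpha\}$ (the VaR), $\Phi_\alpha(R;\theta)=\mathbb E^\theta[R\mid R\le\nu_\alpha(R;\theta)]$ (the CVaR), and $h_j(\mathbf x,y;\theta)=\frac{\partial}{\partial\theta_j}\log f_Y(y;\theta)+\frac{\partial}{\partial\theta_j}\log f_{\mathbf X|Y}(\mathbf x|y;\theta)$. Fix $j\in\{1,\dots,k\}$ and assume the following. (i) For all $\theta$, the distribution function of $R$ is continuous. For all $\theta$ and $1\le i\le k$, the partial derivatives $\frac{\partial}{\partial\theta_i}\nu_\alpha(R;\theta)$ and $\frac{\partial}{\partial\theta_i}\Phi_\alpha(R;\theta)$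 exist and are bounded (uniformly in $\theta$). For all $\mathbf x\in[-b,b]^n$, $y\in\mathcal Y$, $\theta$ and $i$, $f_Y(y;\theta)$ and $f_{\mathbf X|Y}(\mathbf x|y;\theta)$ are positive, and $\frac{\partial}{\partial\theta_i}\log f_Y(y;\theta)$ and $\frac{\partial}{\partial\theta_i}\log f_{\mathbf X|Y}(\mathbf x|y;\theta)$ exist and are bounded (uniformly in $\mathbf x,y,\theta$). (ii) For all $y$ and $\theta$, the set $\{\mathbf x\in[-b,b]^n: r(\mathbf x,y)\le\nu_\alpha(R;\theta)\}$ is the union of finitely many pairwise disjoint, closed, connected sets, each of positive Lebesgue measure. (iii) For all $\theta$, $R$ has a probability density $f_R(\cdot;\theta)$ that is continuous at $\nu_\alpha(R;\theta)$ with $f_R(\nu_\alpha(R;\theta);\theta)>0$, and the function $g(\beta;\theta)=\mathbb E^\theta\big[h_j(\mathbf X,Y;\theta)\,(R-\nu_\alpha(R;\theta))\,\big|\,R=\beta\big]$ (has a version that) is continuous at $\beta=\nu_\alpha(R;\theta)$. Fix $\theta$, let $(\mathbf x_1,y_1),(\mathbf x_2,y_2),\dots$ be i.i.d. with the distribution of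 $(\mathbf X,Y)$ under $\theta$, let $\hat F_N(z)=\frac1N\sum_{i=1}^N\mathbf 1_{r(\mathbf x_i,y_i)\le z}$, let $\tilde\nu_N=\inf\{z:\hat F_N(z)\ge\alpha\}$ be the empirical $\alpha$-quantile, and let $$\Delta_{j;N}=\frac1{\alpha N}\sum_{i=1}^N h_j(\mathbf x_i,y_i;\theta)\,\big(r(\mathbf x_i,y_i)-\tilde\nu_N\big)\,\mathbf 1_{r(\mathbf x_i,y_i)\le\tilde\nu_N}$$ be the GCVaR estimator. Then $\Delta_{j;N}$ is integrable, and $\mathbb E[\Delta_{j;N}]-\frac{\partial}{\partial\theta_j}\Phi_\alpha(R;\theta)=O(N^{-1/2})$ as $N\to\infty$. -/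

import Mathlib

open MeasureTheory ProbabilityTheory Filter Topology Asymptotics

noncomputable section

namespace GCVaR

/-- The `α`-quantile of a (possibly empirical) distribution function `F`:
`inf {z : F z ≥ α}`. -/
def quantile (F : ℝ → ℝ) (α : ℝ) : ℝ := sInf {z : ℝ | α ≤ F z}

/-- The `α`-Value-at-Risk of a real random variable with law `μ`. -/
def VaR (μ : Measure ℝ) (α : ℝ) : ℝ := quantile (cdf μ) α

/-- The `α`-Conditional-Value-at-Risk of a real random variable `Z` with law `μ`:
the conditional expectation `E[Z | Z ≤ ν_α(Z)]` given an event. -/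
def CVaR (μ : Measure ℝ) (α : ℝ) : ℝ := ∫ z, z ∂(cond μ (Set.Iic (VaR μ α)))

/-- The parameter space `ℝ^k`. -/
abbrev Param (k : ℕ) := EuclideanSpace ℝ (Fin k)

/-- `F` has a partial derivative at `θ` with respect to the `j`-th coordinate. -/
def HasPartialAt {k : ℕ} (F : Param k → ℝ) (j : Fin k) (θ : Param k) : Prop :=
  LineDifferentiableAt ℝ F θ (EuclideanSpace.single j 1)

/-- The partial derivative `∂F/∂θ_j` at `θ`. -/
def pderiv {k : ℕ} (F : Param k → ℝ) (j : Fin k) (θ : Param k) : ℝ :=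
  lineDeriv ℝ F θ (EuclideanSpace.single j 1)

/-- The parametrized model: a random vector `X` in the box `[-b,b]^n`, a discrete random
variable `Y` in a countable set `S`, and a bounded reward function `r` on `[-b,b]^n × S`.
Values of `r` and `fX` outside of the box are never used. -/
structure Model (n k : ℕ) (S : Type*) where
  /-- half the side length of the box -/
  b : ℝ
  b_pos : 0 < b
  /-- the reward function -/
  r : (Fin n → ℝ) → S → ℝ
  r_measurable : ∀ y, Measurable fun x => r x y
  r_bounded : ∃ C : ℝ, ∀ x ∈ Set.Icc (fun _ => -b) (fun _ => b), ∀ y, |r x y| ≤ C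
  /-- the probability mass function of `Y` -/
  fY : Param k → S → ℝ
  fY_nonneg : ∀ θ y, 0 ≤ fY θ y
  fY_hasSum : ∀ θ, HasSum (fY θ) 1
  /-- the probability density function `fX θ y x` of `X` at `x`, given `Y = y` -/
  fX : Param k → S → (Fin n → ℝ) → ℝ
  fX_measurable : ∀ θ y, Measurable (fX θ y)
  fX_nonneg : ∀ θ y x, 0 ≤ fX θ y x
  fX_lintegral : ∀ θ y,
    ∫⁻ x in Set.Icc (fun _ => -b) (fun _ => b), ENNReal.ofReal (fX θ y x) = 1

namespace Model

variable {n k : ℕ} {S : Type*} (M : Model n k S)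

/-- The box `[-b,b]^n`. -/
def box : Set (Fin n → ℝ) := Set.Icc (fun _ => -M.b) (fun _ => M.b)

/-- The reward `R = r(X,Y)`, as a function of the outcome `(x, y)`. -/
def R (p : (Fin n → ℝ) × S) : ℝ := M.r p.1 p.2

/-- The joint law of `(X,Y)` at the parameter `θ`: it has the density
`f_Y(y;θ) f_{X|Y}(x|y;θ)` with respect to Lebesgue measure on the box times counting measure. -/
def law [MeasurableSpace S] (θ : Param k) : Measure ((Fin n → ℝ) × S) :=
  (((volume : Measure (Fin n → ℝ)).restrict M.box).prod Measure.count).withDensity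
    fun p => ENNReal.ofReal (M.fY θ p.2 * M.fX θ p.2 p.1)

/-- The law of the reward `R` at the parameter `θ`. -/
def rewardLaw [MeasurableSpace S] (θ : Param k) : Measure ℝ := (M.law θ).map M.R

/-- `ν_α(R;θ)`. -/
def nu [MeasurableSpace S] (α : ℝ) (θ : Param k) : ℝ := VaR (M.rewardLaw θ) α

/-- `Φ_α(R;θ)`. -/
def Phi [MeasurableSpace S] (α : ℝ) (θ : Param k) : ℝ := CVaR (M.rewardLaw θ) α

/-- `∂ log f_Y(y;θ) / ∂θ_j + ∂ log f_{X|Y}(x|y;θ) / ∂θ_j`. -/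
def score (j : Fin k) (θ : Param k) (p : (Fin n → ℝ) × S) : ℝ :=
  pderiv (fun θ' => Real.log (M.fY θ' p.2)) j θ +
    pderiv (fun θ' => Real.log (M.fX θ' p.2 p.1)) j θ

/-- The level set `{x ∈ [-b,b]^n : r(x,y) ≤ ν_α(R;θ)}`. -/
def levelSet [MeasurableSpace S] (α : ℝ) (y : S) (θ : Param k) : Set (Fin n → ℝ) :=
  {x | x ∈ M.box ∧ M.r x y ≤ M.nu α θ}

/-- `R` is a continuous random variable for all `θ`; the VaR and the CVaR have bounded partial
derivatives; the log-likelihoods are defined (the densities are positive) and have bounded partial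
derivatives. -/
structure Regular [MeasurableSpace S] (α : ℝ) : Prop where
  continuous_cdf : ∀ θ, Continuous (cdf (M.rewardLaw θ))
  nu_partial : ∀ θ j, HasPartialAt (M.nu α) j θ
  nu_bounded : ∃ C : ℝ, ∀ θ j, |pderiv (M.nu α) j θ| ≤ C
  Phi_partial : ∀ θ j, HasPartialAt (M.Phi α) j θ
  Phi_bounded : ∃ C : ℝ, ∀ θ j, |pderiv (M.Phi α) j θ| ≤ C
  fY_pos : ∀ θ y, 0 < M.fY θ y
  fX_pos : ∀ θ y, ∀ x ∈ M.box, 0 < M.fX θ y x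
  logfY_partial : ∀ θ y j, HasPartialAt (fun θ' => Real.log (M.fY θ' y)) j θ
  logfY_bounded : ∃ C : ℝ, ∀ θ y j, |pderiv (fun θ' => Real.log (M.fY θ' y)) j θ| ≤ C
  logfX_partial : ∀ θ y, ∀ x ∈ M.box, ∀ j,
    HasPartialAt (fun θ' => Real.log (M.fX θ' y x)) j θ
  logfX_bounded : ∃ C : ℝ, ∀ θ y, ∀ x ∈ M.box, ∀ j,
    |pderiv (fun θ' => Real.log (M.fX θ' y x)) j θ| ≤ C

/-- Every level set is a finite disjoint union of closed connected sets of positive Lebesgue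
measure. -/
def NiceLevelSets [MeasurableSpace S] (α : ℝ) : Prop :=
  ∀ (y : S) (θ : Param k), ∃ (L : ℕ) (D : Fin L → Set (Fin n → ℝ)),
    Pairwise (fun i i' => Disjoint (D i) (D i')) ∧
    (∀ i, IsClosed (D i) ∧ IsConnected (D i) ∧ 0 < volume (D i)) ∧
    M.levelSet α y θ = ⋃ i, D i

/-- `f` is a probability density function of `R` at the parameter `θ`. -/
def IsRewardDensity [MeasurableSpace S] (θ : Param k) (f : ℝ → ℝ) : Prop :=
  Measurable f ∧ (∀ z, 0 ≤ f z) ∧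
    M.rewardLaw θ = (volume : Measure ℝ).withDensity fun z => ENNReal.ofReal (f z)

/-- `g` is (a version of) the function
`β ↦ E^θ[(∂_j log f_Y(Y;θ) + ∂_j log f_{X|Y}(X|Y;θ)) (R - ν_α(R;θ)) | R = β]`. -/
def IsCondScore [MeasurableSpace S] (α : ℝ) (j : Fin k) (θ : Param k) (g : ℝ → ℝ) : Prop :=
  Measurable g ∧
    (fun p => g (M.R p)) =ᵐ[M.law θ]
      condExp (MeasurableSpace.comap M.R inferInstance) (M.law θ)
        (fun p => M.score j θ p * (M.R p - M.nu α θ))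

/-- For all `θ`, the density of `R` and the function `g` (for the coordinate `j`) are continuous
at `ν_α(R;θ)`, and the density is positive there. -/
def SmoothAtVaR [MeasurableSpace S] (α : ℝ) (j : Fin k) : Prop :=
  ∀ θ : Param k,
    (∃ f : ℝ → ℝ, M.IsRewardDensity θ f ∧ ContinuousAt f (M.nu α θ) ∧ 0 < f (M.nu α θ)) ∧
    (∃ g : ℝ → ℝ, M.IsCondScore α j θ g ∧ ContinuousAt g (M.nu α θ))

/-- The empirical distribution function of `R` for the sample `s`. -/
def empiricalCDF {N : ℕ} (s : Fin N → (Fin n → ℝ) × S) (z : ℝ) : ℝ :=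
  (1 / (N : ℝ)) * ∑ i, if M.R (s i) ≤ z then 1 else 0

/-- The empirical `α`-quantile of `R` for the sample `s`. -/
def empiricalVaR (α : ℝ) {N : ℕ} (s : Fin N → (Fin n → ℝ) × S) : ℝ :=
  quantile (M.empiricalCDF s) α

/-- The estimator `Δ_{j;N}` of `∂Φ_α(R;θ)/∂θ_j` for the sample `s`. -/
def estimator (α : ℝ) (j : Fin k) (θ : Param k) {N : ℕ}
    (s : Fin N → (Fin n → ℝ) × S) : ℝ :=
  (1 / (α * N)) * ∑ i, M.score j θ (s i) * (M.R (s i) - M.empiricalVaR α s) *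
    (if M.R (s i) ≤ M.empiricalVaR α s then 1 else 0)

end Model

end GCVaR

end

/-! The proof rests on the Rockafellar–Uryasev representation: when `R` has a continuous
distribution function, the CVaR is the maximum over `c` of `c - α⁻¹ E[(c - R)⁺]`, attained at the
VaR (`sub_le_CVaR`, `VaR_sub_eq_CVaR`).

It gives the gradient by an envelope argument. Freeze `c = ν_α(R;θ)` and move the parameter along
the `j`-th axis: the CVaR minus the frozen objective is nonnegative and vanishes at `θ`, so its
derivative there is zero. The frozen objective depends on the parameter only through the law, and
the likelihood-ratio formula `Regular.hasDerivAt_integral` differentiates it. Hence `∂Φ/∂θ_j = -α⁻¹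
E[h_j (ν - R)⁺]` (`Regular.pderiv_Phi`), with no differentiation of moving level sets.

The estimator is the sample average of the same expression with the empirical VaR as level. At the
true VaR this average is unbiased, and it is Lipschitz in the level with constant `A/α`, where `A`
bounds the score. The bias is therefore at most `(A/α) E|ν̃_N - ν|`. Since the density of `R` is
positive and continuous at `ν`, a deviation `s` of the empirical quantile forces a deviation of
order `s` of the empirical distribution function at a fixed point. Hoeffding's inequality makes this
a Gaussian tail at scale `N^{-1/2}`, and integrating the tail gives the rate. -/

noncomputable section

namespace GCVaR

/-! ### Quantiles and the variational formula for the CVaR. -/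

section Quantile

/-- At its quantile, a continuous distribution function takes the prescribed level. -/
theorem cdf_VaR {μ : Measure ℝ} (hc : Continuous (cdf μ)) {α : ℝ} (hα : α ∈ Set.Ioo (0 : ℝ) 1) :
    cdf μ (VaR μ α) = α := by
  have hex : ∃ z, cdf μ z = α := by
    have h0 := tendsto_cdf_atBot μ
    have h1 := tendsto_cdf_atTop μ
    obtain ⟨a, ha⟩ := (h0.eventually_lt_const hα.1).exists
    obtain ⟨b, hb⟩ := (h1.eventually_const_lt hα.2).exists
    exact mem_range_of_exists_le_of_exists_ge hc ⟨a, ha.le⟩ ⟨b, hb.le⟩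
  obtain ⟨z, hz⟩ := hex
  -- Without a lower bound the infimum would be the default value 0.
  have hbdd : BddBelow {z : ℝ | α ≤ cdf μ z} := by
    obtain ⟨a, ha⟩ := ((tendsto_cdf_atBot μ).eventually_lt_const hα.1).exists
    refine ⟨a, fun w hw => ?_⟩
    by_contra hlt
    exact absurd (le_trans hw (monotone_cdf μ (not_le.1 hlt).le)) (not_le.2 ha)
  have hclosed : IsClosed {z : ℝ | α ≤ cdf μ z} := isClosed_le continuous_const hc
  apply le_antisymm
  · exact (monotone_cdf μ (csInf_le hbdd (show z ∈ {z : ℝ | α ≤ cdf μ z} by simp [hz]))).trans_eq hz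
  · exact hclosed.csInf_mem ⟨z, by simp [hz]⟩ hbdd

theorem CVaR_eq {μ : Measure ℝ} [IsProbabilityMeasure μ] {α : ℝ}
    (h : cdf μ (VaR μ α) = α) :
    CVaR μ α = α⁻¹ * ∫ z in Set.Iic (VaR μ α), z ∂μ := by
  rw [cdf_eq_real] at h
  unfold CVaR
  rw [ProbabilityTheory.cond, integral_smul_measure, ENNReal.toReal_inv, ← measureReal_def, h,
    smul_eq_mul]

theorem integrable_max_sub {μ : Measure ℝ} [IsFiniteMeasure μ]
    (hi : Integrable (fun z : ℝ => z) μ) (c : ℝ) : Integrable (fun z => max (c - z) 0) μ :=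
  ((integrable_const c).sub hi).pos_part

theorem integral_Iic_sub {μ : Measure ℝ} [IsProbabilityMeasure μ] {α : ℝ}
    (hi : Integrable (fun z : ℝ => z) μ) (h : cdf μ (VaR μ α) = α) (c : ℝ) :
    ∫ z in Set.Iic (VaR μ α), (c - z) ∂μ = c * α - ∫ z in Set.Iic (VaR μ α), z ∂μ := by
  rw [cdf_eq_real] at h
  rw [integral_sub (integrable_const c) hi.integrableOn]
  simp [h, mul_comm]

/-- The Rockafellar–Uryasev lower bound for the CVaR. -/
theorem sub_le_CVaR {μ : Measure ℝ} [IsProbabilityMeasure μ] {α : ℝ} (hα : 0 < α)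
    (hi : Integrable (fun z : ℝ => z) μ) (h : cdf μ (VaR μ α) = α) (c : ℝ) :
    c - α⁻¹ * ∫ z, max (c - z) 0 ∂μ ≤ CVaR μ α := by
  -- The half-line up to the VaR has mass exactly `α`, so its integral of `c - z` is `α (c - CVaR)`.
  -- Passing to the positive part and then to the whole line only increases it.
  have h1 : ∫ z in Set.Iic (VaR μ α), (c - z) ∂μ ≤ ∫ z, max (c - z) 0 ∂μ :=
    calc ∫ z in Set.Iic (VaR μ α), (c - z) ∂μ
        ≤ ∫ z in Set.Iic (VaR μ α), max (c - z) 0 ∂μ :=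
          integral_mono ((integrable_const c).sub hi).integrableOn
            (integrable_max_sub hi c).integrableOn fun z => le_max_left _ _
      _ ≤ _ := setIntegral_le_integral (integrable_max_sub hi c)
            (Eventually.of_forall fun z => le_max_right _ _)
  rw [integral_Iic_sub hi h] at h1
  rw [CVaR_eq h]
  have h2 := mul_le_mul_of_nonneg_left h1 (inv_pos.2 hα).le
  have h3 : α⁻¹ * (c * α - ∫ z in Set.Iic (VaR μ α), z ∂μ) =
      c - α⁻¹ * ∫ z in Set.Iic (VaR μ α), z ∂μ := by field_simp
  linarith

/-- The Rockafellar–Uryasev bound is attained at the VaR. -/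
theorem VaR_sub_eq_CVaR {μ : Measure ℝ} [IsProbabilityMeasure μ] {α : ℝ} (hα : 0 < α)
    (hi : Integrable (fun z : ℝ => z) μ) (h : cdf μ (VaR μ α) = α) :
    VaR μ α - α⁻¹ * ∫ z, max (VaR μ α - z) 0 ∂μ = CVaR μ α := by
  have h1 : ∫ z, max (VaR μ α - z) 0 ∂μ = ∫ z in Set.Iic (VaR μ α), (VaR μ α - z) ∂μ := by
    rw [← integral_indicator measurableSet_Iic]
    congr 1 with z
    by_cases hz : z ≤ VaR μ α
    · simp [hz]
    · simp [hz, (not_le.1 hz).le]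
  rw [h1, integral_Iic_sub hi h, CVaR_eq h]
  field_simp
  ring

end Quantile

/-! ### Linear growth of the distribution function at the quantile. -/

section Density

/-- A density that is continuous and positive at `q` makes the distribution function grow at
least linearly around `q`. -/
theorem exists_linear_growth_cdf {μ : Measure ℝ} [IsProbabilityMeasure μ] {f : ℝ → ℝ} {q : ℝ}
    (hf : μ = (volume : Measure ℝ).withDensity fun z => ENNReal.ofReal (f z))
    (hc : ContinuousAt f q) (hpos : 0 < f q) (B : ℝ) :
    ∃ c > 0, ∀ s, 0 < s → s ≤ B → cdf μ q + c * s ≤ cdf μ (q + s) ∧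
      cdf μ (q - s) ≤ cdf μ q - c * s := by
  obtain ⟨δ, hδ, hball⟩ := Metric.eventually_nhds_iff.1 (hc.eventually_const_lt (half_lt_self hpos))
  set m := f q / 2 with hm
  have hm0 : 0 < m := by positivity
  have key : ∀ u v, q - δ < u → u ≤ v → v < q + δ → m * (v - u) ≤ cdf μ v - cdf μ u := by
    intro u v hu huv hv
    have h1 : ENNReal.ofReal (cdf μ v - cdf μ u) = μ (Set.Ioc u v) := by
      conv_rhs => rw [← measure_cdf μ]
      rw [StieltjesFunction.measure_Ioc]
    have h2 : ENNReal.ofReal (m * (v - u)) ≤ μ (Set.Ioc u v) := by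
      rw [hf, withDensity_apply _ measurableSet_Ioc]
      calc ENNReal.ofReal (m * (v - u)) = ∫⁻ _ in Set.Ioc u v, ENNReal.ofReal m := by
            simp [ENNReal.ofReal_mul hm0.le]
        _ ≤ _ := setLIntegral_mono' measurableSet_Ioc fun z hz =>
            ENNReal.ofReal_le_ofReal (hball (by
              rw [Real.dist_eq, abs_lt]; constructor <;> linarith [hz.1, hz.2])).le
    rw [← h1] at h2
    exact (ENNReal.ofReal_le_ofReal_iff (sub_nonneg.2 (monotone_cdf μ huv))).1 h2
  set η := δ / 2 with hη
  have hη0 : 0 < η := by positivity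
  -- The density bound works only within distance `η`. Farther out monotonicity keeps the gain `m *
  -- η`, and scaling the slope by `η / K ≤ 1` covers all `s ≤ B`; the maximum keeps `K` positive for
  -- any `B`.
  set K := max B η with hK
  have hK0 : 0 < K := lt_of_lt_of_le hη0 (le_max_right _ _)
  refine ⟨m * (η / K), by positivity, fun s hs hsB => ?_⟩
  have hsK : s ≤ K := hsB.trans (le_max_left _ _)
  have hratio : η / K ≤ 1 := (div_le_one hK0).2 (le_max_right _ _)
  have hle : η / K * s ≤ min s η := by
    refine le_min ?_ ?_
    · exact mul_le_of_le_one_left hs.le hratio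
    · rw [div_mul_eq_mul_div, div_le_iff₀ hK0]
      exact mul_le_mul_of_nonneg_left hsK hη0.le
  have hmin0 : 0 ≤ min s η := le_min hs.le hη0.le
  have hminη : min s η ≤ η := min_le_right _ _
  have hms : min s η ≤ s := min_le_left _ _
  have hmul := mul_le_mul_of_nonneg_left hle hm0.le
  have k1 := key q (q + min s η) (by linarith) (by linarith) (by linarith)
  have k2 := key (q - min s η) q (by linarith) (by linarith) (by linarith)
  have m1 := monotone_cdf μ (show q + min s η ≤ q + s by linarith)
  have m2 := monotone_cdf μ (show q - s ≤ q - min s η by linarith)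
  constructor <;> nlinarith

end Density

/-! ### Empirical distribution functions and their quantiles. -/

section Empirical

/-- The empirical distribution function of a real sample. -/
def empirical {N : ℕ} (x : Fin N → ℝ) (z : ℝ) : ℝ :=
  (1 / (N : ℝ)) * ∑ i, if x i ≤ z then 1 else 0

theorem monotone_empirical {N : ℕ} (x : Fin N → ℝ) : Monotone (empirical x) := by
  intro u v huv
  refine mul_le_mul_of_nonneg_left (Finset.sum_le_sum fun i _ => ?_) (by positivity)
  by_cases h : x i ≤ u
  · simp [h, h.trans huv]
  · simp only [h, if_false]
    split_ifs <;> norm_num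

theorem empirical_eq_one {N : ℕ} (hN : 0 < N) {x : Fin N → ℝ} {z : ℝ} (h : ∀ i, x i ≤ z) :
    empirical x z = 1 := by
  have : (N : ℝ) ≠ 0 := by positivity
  simp [empirical, h, this]

theorem empirical_eq_zero {N : ℕ} {x : Fin N → ℝ} {z : ℝ} (h : ∀ i, z < x i) :
    empirical x z = 0 := by
  simp [empirical, fun i => not_le.2 (h i)]

variable {α : ℝ} {N : ℕ}

theorem le_of_le_empirical (hα : 0 < α) {x : Fin N → ℝ} {z C : ℝ}
    (hx : ∀ i, C ≤ x i) (h : α ≤ empirical x z) : C ≤ z := by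
  by_contra hz
  rw [empirical_eq_zero fun i => (not_le.1 hz).trans_le (hx i)] at h
  exact absurd h (not_le.2 hα)

theorem bddBelow_empirical (hα : 0 < α) (x : Fin N → ℝ) :
    BddBelow {z | α ≤ empirical x z} := by
  obtain ⟨C, hC⟩ := (Set.finite_range x).bddBelow
  exact ⟨C, fun z hz => le_of_le_empirical hα (fun i => hC ⟨i, rfl⟩) hz⟩

theorem nonempty_empirical (hα : α < 1) (hN : 0 < N) (x : Fin N → ℝ) :
    {z | α ≤ empirical x z}.Nonempty := by
  obtain ⟨C, hC⟩ := (Set.finite_range x).bddAbove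
  exact ⟨C, by simp [empirical_eq_one hN fun i => hC ⟨i, rfl⟩, hα.le]⟩

/-- The strict inequality provides a point of the superlevel set below `z`, and monotonicity
finishes; right continuity is not needed. -/
theorem le_empirical_of_quantile_lt (hα : α ∈ Set.Ioo (0 : ℝ) 1) (hN : 0 < N) {x : Fin N → ℝ}
    {z : ℝ} (h : quantile (empirical x) α < z) : α ≤ empirical x z := by
  obtain ⟨w, hw, hwz⟩ := exists_lt_of_csInf_lt (nonempty_empirical hα.2 hN x) h
  exact le_trans hw (monotone_empirical x hwz.le)

theorem quantile_empirical_le (hα : 0 < α) {x : Fin N → ℝ}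
    {z : ℝ} (h : α ≤ empirical x z) : quantile (empirical x) α ≤ z :=
  csInf_le (bddBelow_empirical hα x) h

theorem abs_quantile_empirical_le (hα : α ∈ Set.Ioo (0 : ℝ) 1) (hN : 0 < N) {x : Fin N → ℝ}
    {C : ℝ} (hx : ∀ i, |x i| ≤ C) : |quantile (empirical x) α| ≤ C := by
  rw [abs_le]
  constructor
  · exact le_csInf (nonempty_empirical hα.2 hN x) fun z hz =>
      le_of_le_empirical hα.1 (fun i => (abs_le.1 (hx i)).1) hz
  · refine quantile_empirical_le hα.1 ?_
    rw [empirical_eq_one hN fun i => (abs_le.1 (hx i)).2]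
    exact hα.2.le

theorem measurable_empirical (z : ℝ) : Measurable fun x : Fin N → ℝ => empirical x z := by
  refine Measurable.const_mul (Finset.measurable_sum _ fun i _ => ?_) _
  exact Measurable.ite (measurableSet_le (measurable_pi_apply i) measurable_const)
    measurable_const measurable_const

/-- The quantile is below `z` exactly when the empirical distribution function reaches `α` at some
rational below `z`, which is a countable union of measurable conditions. -/
theorem measurable_quantile_empirical (hα : α ∈ Set.Ioo (0 : ℝ) 1) :
    Measurable fun x : Fin N → ℝ => quantile (empirical x) α := by
  rcases N.eq_zero_or_pos with rfl | hN
  · exact measurable_of_finite _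
  refine measurable_of_Iio fun z => ?_
  have : (fun x : Fin N → ℝ => quantile (empirical x) α) ⁻¹' Set.Iio z =
      ⋃ w : {w : ℚ // (w : ℝ) < z}, {x | α ≤ empirical x (w : ℚ)} := by
    ext x
    simp only [Set.mem_preimage, Set.mem_Iio, Set.mem_iUnion, Set.mem_ofPred_eq]
    constructor
    · intro h
      obtain ⟨w, hw, hwz⟩ := exists_rat_btwn h
      exact ⟨⟨w, hwz⟩, le_empirical_of_quantile_lt hα hN hw⟩
    · rintro ⟨⟨w, hwz⟩, hw⟩
      exact (quantile_empirical_le hα.1 hw).trans_lt hwz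
  rw [this]
  exact MeasurableSet.iUnion fun w => measurableSet_le measurable_const (measurable_empirical _)

end Empirical

/-! ### Hoeffding bounds and the mean error of the empirical quantile. -/

section Concentration

variable {Ω : Type*} [MeasurableSpace Ω] {P : Measure Ω} {μ : Measure ℝ} [IsProbabilityMeasure μ]

theorem integral_ite_le_of_hasLaw {Y : Ω → ℝ} (h : HasLaw Y μ P) (z : ℝ) :
    ∫ ω, (if Y ω ≤ z then (1 : ℝ) else 0) ∂P = cdf μ z := by
  have := h.integral_comp (f := Set.indicator (Set.Iic z) fun _ => (1 : ℝ))
    ((measurable_const.indicator measurableSet_Iic).aestronglyMeasurable)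
  rw [cdf_eq_real, ← integral_indicator_one measurableSet_Iic]
  exact this

theorem measurable_ite_le (z : ℝ) : Measurable fun x : ℝ => if x ≤ z then (1 : ℝ) else 0 :=
  Measurable.ite measurableSet_Iic measurable_const measurable_const

variable [IsProbabilityMeasure P]

/-- Hoeffding's inequality for the average of `N` independent `[0,1]`-valued variables. -/
theorem hoeffding_average {B : ℕ → Ω → ℝ} (hB : iIndepFun B P)
    (hm : ∀ i, AEMeasurable (B i) P) (h01 : ∀ i, ∀ᵐ ω ∂P, B i ω ∈ Set.Icc (0 : ℝ) 1) {p : ℝ}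
    (hp : ∀ i, ∫ ω, B i ω ∂P = p) {N : ℕ} (hN : 0 < N) {t : ℝ} (ht : 0 ≤ t) :
    P.real {ω | p + t ≤ (1 / (N : ℝ)) * ∑ i : Fin N, B i ω} ≤ Real.exp (-(2 * N * t ^ 2)) := by
  -- An interval of length 1 gives variance proxy `1/4`, hence the factor 2 in the exponent.
  have hsub : ∀ i, HasSubgaussianMGF (fun ω => B i ω - p) ((‖(1 : ℝ) - 0‖₊ / 2) ^ 2) P := by
    intro i
    have := hasSubgaussianMGF_of_mem_Icc (hm i) (h01 i)
    rwa [hp i] at this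
  have hind : iIndepFun (fun i ω => B i ω - p) P :=
    hB.comp (fun _ x => x - p) fun _ => measurable_id.sub_const p
  have hN' : (0 : ℝ) < N := by exact_mod_cast hN
  have := HasSubgaussianMGF.measure_sum_range_ge_le_of_iIndepFun hind (n := N)
    (fun i _ => hsub i) (ε := N * t) (by positivity)
  have hset : {ω | p + t ≤ (1 / (N : ℝ)) * ∑ i : Fin N, B i ω} =
      {ω | N * t ≤ ∑ i ∈ Finset.range N, (B i ω - p)} := by
    ext ω
    simp only [Set.mem_ofPred_eq, Finset.sum_sub_distrib, Finset.sum_const, Finset.card_range,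
      nsmul_eq_mul, Finset.sum_range]
    rw [one_div, ← div_eq_inv_mul, le_div_iff₀ hN']
    constructor <;> intro h <;> linarith
  rw [hset]
  refine this.trans_eq ?_
  congr 1
  simp
  field_simp

variable {X : ℕ → Ω → ℝ}

theorem measureReal_le_empirical (hind : iIndepFun X P) (hX : ∀ i, HasLaw (X i) μ P) {N : ℕ}
    (hN : 0 < N) (z : ℝ) {t : ℝ} (ht : 0 ≤ t) :
    P.real {ω | cdf μ z + t ≤ empirical (fun i : Fin N => X i ω) z} ≤
      Real.exp (-(2 * N * t ^ 2)) :=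
  hoeffding_average (B := fun i ω => if X i ω ≤ z then 1 else 0)
    (hind.comp (fun _ x => if x ≤ z then (1 : ℝ) else 0) fun _ => measurable_ite_le z)
    (fun i => (measurable_ite_le z).comp_aemeasurable (hX i).aemeasurable)
    (fun i => Eventually.of_forall fun ω => by split_ifs <;> simp)
    (fun i => integral_ite_le_of_hasLaw (hX i) z) hN ht

theorem measureReal_empirical_le (hind : iIndepFun X P) (hX : ∀ i, HasLaw (X i) μ P) {N : ℕ}
    (hN : 0 < N) (z : ℝ) {t : ℝ} (ht : 0 ≤ t) :
    P.real {ω | empirical (fun i : Fin N => X i ω) z ≤ cdf μ z - t} ≤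
      Real.exp (-(2 * N * t ^ 2)) := by
  have hN' : (N : ℝ) ≠ 0 := by positivity
  have hint : ∀ i, Integrable (fun ω => if X i ω ≤ z then (1 : ℝ) else 0) P := fun i =>
    Integrable.of_bound
      ((measurable_ite_le z).comp_aemeasurable (hX i).aemeasurable).aestronglyMeasurable 1
      (Eventually.of_forall fun ω => by split_ifs <;> simp)
  -- The lower tail is the upper tail of the complementary indicators, which have mean `1 - cdf μ
  -- z`.
  have := hoeffding_average (B := fun i ω => 1 - if X i ω ≤ z then 1 else 0) (p := 1 - cdf μ z)
    (hind.comp (fun _ x => 1 - if x ≤ z then (1 : ℝ) else 0)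
      fun _ => (measurable_ite_le z).const_sub 1)
    (fun i => ((measurable_ite_le z).const_sub 1).comp_aemeasurable (hX i).aemeasurable)
    (fun i => Eventually.of_forall fun ω => by split_ifs <;> simp)
    (fun i => by
      rw [integral_sub (integrable_const _) (hint i), integral_ite_le_of_hasLaw (hX i) z]
      simp) hN ht
  refine le_trans (measureReal_mono fun ω hω => ?_) this
  simp only [Set.mem_ofPred_eq, empirical] at hω ⊢
  rw [Finset.sum_sub_distrib, mul_sub]
  simp only [Finset.sum_const, Finset.card_univ, Fintype.card_fin, nsmul_eq_mul, mul_one,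
    one_div_mul_cancel hN']
  linarith

/-- The mean absolute error of the empirical quantile is `O(N^{-1/2})` if the distribution
function grows linearly around the quantile. -/
theorem integral_abs_quantile_empirical_sub_le {α : ℝ} (hα : α ∈ Set.Ioo (0 : ℝ) 1)
    (hind : iIndepFun X P) (hX : ∀ i, HasLaw (X i) μ P) {C q c : ℝ}
    (hC : ∀ i, ∀ᵐ ω ∂P, |X i ω| ≤ C) (hq : |q| ≤ C) (hc : 0 < c)
    (hgrow : ∀ s, 0 < s → s ≤ 2 * C → α + c * s ≤ cdf μ (q + s) ∧ cdf μ (q - s) ≤ α - c * s)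
    {N : ℕ} (hN : 0 < N) :
    Integrable (fun ω => |quantile (empirical fun i : Fin N => X i ω) α - q|) P ∧
    ∫ ω, |quantile (empirical fun i : Fin N => X i ω) α - q| ∂P ≤
      √(Real.pi / (2 * c ^ 2 * N)) := by
  have hN' : (0 : ℝ) < N := by exact_mod_cast hN
  have hCae : ∀ᵐ ω ∂P, ∀ i, |X i ω| ≤ C := ae_all_iff.2 hC
  have hbd : ∀ᵐ ω ∂P, |quantile (empirical fun i : Fin N => X i ω) α - q| ≤ 2 * C := by
    filter_upwards [hCae] with ω hω
    have h1 := abs_quantile_empirical_le hα hN (x := fun i : Fin N => X i ω) (fun i => hω i)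
    have h2 := abs_sub (quantile (empirical fun i : Fin N => X i ω) α) q
    linarith
  have hmeas : AEMeasurable (fun ω => |quantile (empirical fun i : Fin N => X i ω) α - q|) P := by
    have h1 : AEMeasurable (fun ω => fun i : Fin N => X i ω) P :=
      aemeasurable_pi_lambda _ fun i => (hX i).aemeasurable
    exact (((measurable_quantile_empirical hα).comp_aemeasurable h1).sub_const q).abs
  have hint : Integrable (fun ω => |quantile (empirical fun i : Fin N => X i ω) α - q|) P :=
    Integrable.of_bound hmeas.aestronglyMeasurable (2 * C) (by simpa using hbd)
  refine ⟨hint, ?_⟩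
  -- Layer-cake formula: the mean is the integral of the tail probabilities.
  rw [hint.integral_eq_integral_meas_lt (Eventually.of_forall fun ω => abs_nonneg _)]
  have htail : ∀ s, 0 < s →
      P.real {ω | s < |quantile (empirical fun i : Fin N => X i ω) α - q|} ≤
        2 * Real.exp (-(2 * c ^ 2 * N) * s ^ 2) := by
    intro s hs
    -- Both quantiles lie in `[-C, C]` almost surely, so growth is needed only up to `2 * C`; beyond
    -- that the tail is null.
    rcases le_or_gt s (2 * C) with hsC | hsC
    · obtain ⟨g1, g2⟩ := hgrow s hs hsC
      have hcs : 0 ≤ c * s := by positivity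
      -- An empirical quantile above `q + s` means that the empirical distribution function is still
      -- below `α` at `q + s`; one below `q - s` means that it has reached `α` at `q - s`. By the
      -- growth hypothesis either is a deviation of at least `c * s`.
      have hsub : {ω | s < |quantile (empirical fun i : Fin N => X i ω) α - q|} ⊆
          {ω | empirical (fun i : Fin N => X i ω) (q + s) ≤ cdf μ (q + s) - c * s} ∪
          {ω | cdf μ (q - s) + c * s ≤ empirical (fun i : Fin N => X i ω) (q - s)} := by
        intro ω hω
        rw [Set.mem_ofPred_eq] at hω
        rcases lt_abs.1 hω with h | h
        · left
          have : ¬ α ≤ empirical (fun i : Fin N => X i ω) (q + s) := fun h' => by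
            linarith [quantile_empirical_le hα.1 h']
          simp only [Set.mem_ofPred_eq]
          linarith [not_le.1 this]
        · right
          have := le_empirical_of_quantile_lt hα hN
            (show quantile (empirical fun i : Fin N => X i ω) α < q - s by linarith)
          simp only [Set.mem_ofPred_eq]
          linarith
      have e : Real.exp (-(2 * c ^ 2 * N) * s ^ 2) = Real.exp (-(2 * N * (c * s) ^ 2)) := by
        congr 1; ring
      rw [e, two_mul]
      exact (measureReal_mono hsub).trans ((measureReal_union_le _ _).trans
        (add_le_add (measureReal_empirical_le hind hX hN _ hcs)
          (measureReal_le_empirical hind hX hN _ hcs)))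
    · have : P {ω | s < |quantile (empirical fun i : Fin N => X i ω) α - q|} = 0 := by
        rw [measure_eq_zero_iff_ae_notMem]
        filter_upwards [hbd] with ω hω
        simpa using hω.trans hsC.le
      rw [measureReal_def, this]
      simp only [ENNReal.toReal_zero]
      positivity
  have hb : 0 < 2 * c ^ 2 * N := by positivity
  calc ∫ s in Set.Ioi (0 : ℝ),
        P.real {ω | s < |quantile (empirical fun i : Fin N => X i ω) α - q|}
      ≤ ∫ s in Set.Ioi (0 : ℝ), 2 * Real.exp (-(2 * c ^ 2 * N) * s ^ 2) := by
        refine integral_mono_of_nonneg (Eventually.of_forall fun s => measureReal_nonneg)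
          ((integrable_exp_neg_mul_sq hb).const_mul 2).integrableOn ?_
        exact (ae_restrict_iff' measurableSet_Ioi).2 (Eventually.of_forall fun s hs => htail s hs)
    _ = √(Real.pi / (2 * c ^ 2 * N)) := by
        rw [integral_const_mul, integral_gaussian_Ioi]
        ring

end Concentration

end GCVaR

end

/-! ### Differentiation in the parameter and the gradient of the CVaR. -/

noncomputable section

namespace GCVaR

section Line

variable {k : ℕ}

theorem HasPartialAt.hasDerivAt {F : Param k → ℝ} {j : Fin k} {θ : Param k} {t : ℝ}
    (h : HasPartialAt F j (θ + t • EuclideanSpace.single j (1 : ℝ))) :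
    HasDerivAt (fun s : ℝ => F (θ + s • EuclideanSpace.single j (1 : ℝ)))
      (pderiv F j (θ + t • EuclideanSpace.single j (1 : ℝ))) t := by
  have h1 : HasDerivAt (fun s : ℝ => F ((θ + t • EuclideanSpace.single j (1 : ℝ)) +
      s • EuclideanSpace.single j (1 : ℝ)))
      (pderiv F j (θ + t • EuclideanSpace.single j (1 : ℝ))) (t - t) := by
    rw [sub_self]
    exact h.hasLineDerivAt
  have h2 := h1.comp_sub_const t t
  refine h2.congr_of_eventuallyEq (Eventually.of_forall fun s => ?_)
  dsimp only
  rw [add_assoc, ← add_smul, add_sub_cancel]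

end Line

namespace Model

variable {n k : ℕ} {S : Type*} (M : Model n k S)

/-- The joint density of `(X,Y)`. -/
def dens (θ : Param k) (p : (Fin n → ℝ) × S) : ℝ := M.fY θ p.2 * M.fX θ p.2 p.1

theorem dens_nonneg (θ : Param k) (p : (Fin n → ℝ) × S) : 0 ≤ M.dens θ p :=
  mul_nonneg (M.fY_nonneg _ _) (M.fX_nonneg _ _ _)

variable [MeasurableSpace S]

/-- The reference measure: Lebesgue measure on the box times counting measure. -/
def base : Measure ((Fin n → ℝ) × S) :=
  ((volume : Measure (Fin n → ℝ)).restrict M.box).prod Measure.count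

theorem law_eq (θ : Param k) :
    M.law θ = M.base.withDensity fun p => ENNReal.ofReal (M.dens θ p) := rfl

theorem law_absolutelyContinuous (θ : Param k) : M.law θ ≪ M.base :=
  withDensity_absolutelyContinuous _ _

theorem ae_base_mem_box : ∀ᵐ p ∂M.base, p.1 ∈ M.box :=
  Measure.quasiMeasurePreserving_fst.ae (ae_restrict_mem measurableSet_Icc)

theorem exists_abs_R_le : ∃ C : ℝ, 0 ≤ C ∧ ∀ᵐ p ∂M.base, |M.R p| ≤ C := by
  obtain ⟨C, hC⟩ := M.r_bounded
  exact ⟨max C 0, le_max_right _ _,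
    M.ae_base_mem_box.mono fun p hp => (hC p.1 hp p.2).trans (le_max_left _ _)⟩

section Regular

variable {M} {α : ℝ}

theorem Regular.hasDerivAt_log_dens (h : M.Regular α) (j : Fin k) (θ : Param k)
    {p : (Fin n → ℝ) × S} (hp : p.1 ∈ M.box) (t : ℝ) :
    HasDerivAt (fun s : ℝ => Real.log (M.dens (θ + s • EuclideanSpace.single j (1 : ℝ)) p))
      (M.score j (θ + t • EuclideanSpace.single j (1 : ℝ)) p) t := by
  have h1 := (h.logfY_partial (θ + t • EuclideanSpace.single j (1 : ℝ)) p.2 j).hasDerivAt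
  have h2 := (h.logfX_partial (θ + t • EuclideanSpace.single j (1 : ℝ)) p.2 p.1 hp j).hasDerivAt
  refine (h1.add h2).congr_of_eventuallyEq (Eventually.of_forall fun s => ?_)
  exact Real.log_mul (h.fY_pos _ _).ne' (h.fX_pos _ _ _ hp).ne'

theorem Regular.dens_pos (h : M.Regular α) (θ : Param k)
    {p : (Fin n → ℝ) × S} (hp : p.1 ∈ M.box) : 0 < M.dens θ p :=
  mul_pos (h.fY_pos _ _) (h.fX_pos _ _ _ hp)

theorem Regular.exists_abs_score_le (h : M.Regular α) (j : Fin k) :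
    ∃ C : ℝ, 0 ≤ C ∧ ∀ θ, ∀ p : (Fin n → ℝ) × S, p.1 ∈ M.box → |M.score j θ p| ≤ C := by
  obtain ⟨C, hC⟩ := h.logfY_bounded
  obtain ⟨D, hD⟩ := h.logfX_bounded
  refine ⟨max (C + D) 0, le_max_right _ _, fun θ p hp => le_trans ?_ (le_max_left _ _)⟩
  exact (abs_add_le _ _).trans (add_le_add (hC θ p.2 j) (hD θ p.2 p.1 hp j))

theorem Regular.hasDerivAt_dens (h : M.Regular α) (j : Fin k) (θ : Param k)
    {p : (Fin n → ℝ) × S} (hp : p.1 ∈ M.box) (t : ℝ) :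
    HasDerivAt (fun s : ℝ => M.dens (θ + s • EuclideanSpace.single j (1 : ℝ)) p)
      (M.dens (θ + t • EuclideanSpace.single j (1 : ℝ)) p *
        M.score j (θ + t • EuclideanSpace.single j (1 : ℝ)) p) t := by
  have := (h.hasDerivAt_log_dens j θ hp t).exp
  simpa only [Real.exp_log (h.dens_pos _ hp)] using this

/-- The log-density is `C`-Lipschitz along the coordinate line by the mean value inequality. The
bound supplies an integrable majorant for differentiation under the integral sign. -/
theorem Regular.dens_le (h : M.Regular α) {j : Fin k} {C : ℝ}
    (hC : ∀ θ, ∀ p : (Fin n → ℝ) × S, p.1 ∈ M.box → |M.score j θ p| ≤ C) (θ : Param k)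
    {p : (Fin n → ℝ) × S} (hp : p.1 ∈ M.box) (t : ℝ) :
    M.dens (θ + t • EuclideanSpace.single j (1 : ℝ)) p ≤ Real.exp (C * |t|) * M.dens θ p := by
  have := Convex.norm_image_sub_le_of_norm_hasDerivWithin_le (s := Set.univ) (x := (0 : ℝ))
    (y := t) (fun s _ => (h.hasDerivAt_log_dens j θ hp s).hasDerivWithinAt)
    (fun s _ => by rw [Real.norm_eq_abs]; exact hC _ p hp) convex_univ trivial trivial
  simp only [zero_smul, add_zero, sub_zero, Real.norm_eq_abs] at this
  rw [← Real.log_le_log_iff (h.dens_pos _ hp) (mul_pos (Real.exp_pos _) (h.dens_pos _ hp)),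
    Real.log_mul (Real.exp_pos _).ne' (h.dens_pos _ hp).ne', Real.log_exp]
  linarith [le_of_abs_le this]

end Regular

variable [Countable S] [DiscreteMeasurableSpace S]

theorem measurable_R : Measurable M.R :=
  measurable_from_prod_countable_left fun y => M.r_measurable y

theorem measurable_dens (θ : Param k) : Measurable (M.dens θ) :=
  measurable_from_prod_countable_left fun y => (M.fX_measurable θ y).const_mul (M.fY θ y)

instance isProbabilityMeasure_law (θ : Param k) : IsProbabilityMeasure (M.law θ) := by
  constructor
  have hm : Measurable fun p => ENNReal.ofReal (M.dens θ p) :=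
    (M.measurable_dens θ).ennreal_ofReal
  rw [law_eq, withDensity_apply _ MeasurableSet.univ, Measure.restrict_univ, base,
    lintegral_prod_symm' _ hm, lintegral_count]
  have h : ∀ y, ∫⁻ x in M.box, ENNReal.ofReal (M.dens θ (x, y)) = ENNReal.ofReal (M.fY θ y) := by
    intro y
    simp only [dens, ENNReal.ofReal_mul (M.fY_nonneg θ y)]
    rw [lintegral_const_mul _ (M.fX_measurable θ y).ennreal_ofReal, box, M.fX_lintegral, mul_one]
  simp only [h]
  rw [← ENNReal.ofReal_tsum_of_nonneg (M.fY_nonneg θ) (M.fY_hasSum θ).summable,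
    (M.fY_hasSum θ).tsum_eq, ENNReal.ofReal_one]

instance isProbabilityMeasure_rewardLaw (θ : Param k) :
    IsProbabilityMeasure (M.rewardLaw θ) :=
  Measure.isProbabilityMeasure_map M.measurable_R.aemeasurable

theorem integral_law (θ : Param k) (φ : (Fin n → ℝ) × S → ℝ) :
    ∫ p, φ p ∂M.law θ = ∫ p, M.dens θ p * φ p ∂M.base := by
  rw [law_eq, integral_withDensity_eq_integral_toReal_smul
    (M.measurable_dens θ).ennreal_ofReal (by simp)]
  simp [ENNReal.toReal_ofReal (M.dens_nonneg θ _)]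

theorem integrable_dens (θ : Param k) : Integrable (M.dens θ) M.base := by
  refine ⟨(M.measurable_dens θ).aestronglyMeasurable, ?_⟩
  rw [hasFiniteIntegral_iff_ofReal (Eventually.of_forall (M.dens_nonneg θ)), ← setLIntegral_univ,
    ← withDensity_apply _ MeasurableSet.univ, ← law_eq]
  exact measure_lt_top _ _

theorem integrable_rewardLaw (θ : Param k) : Integrable (fun z : ℝ => z) (M.rewardLaw θ) := by
  obtain ⟨C, -, hC⟩ := M.exists_abs_R_le
  refine (integrable_map_measure aestronglyMeasurable_id M.measurable_R.aemeasurable).2 ?_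
  exact Integrable.of_bound M.measurable_R.aestronglyMeasurable C
    ((M.law_absolutelyContinuous θ).ae_le hC)

section Regular

variable {M} {α : ℝ}

/-- The score is a limit of difference quotients of the log-density, each measurable in the outcome.
Convergence is known only over the box, hence almost everywhere. -/
theorem Regular.aemeasurable_score (h : M.Regular α) (j : Fin k) (θ : Param k) :
    AEMeasurable (M.score j θ) M.base := by
  refine aemeasurable_of_tendsto_metrizable_ae (𝓝[≠] (0 : ℝ))
    (f := fun t p => t⁻¹ • (Real.log (M.dens (θ + (0 + t) • EuclideanSpace.single j (1 : ℝ)) p) -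
      Real.log (M.dens (θ + (0 : ℝ) • EuclideanSpace.single j (1 : ℝ)) p))) (fun t => ?_) ?_
  · exact (((M.measurable_dens _).log.sub (M.measurable_dens _).log).const_smul t⁻¹).aemeasurable
  · filter_upwards [M.ae_base_mem_box] with p hp
    have := (h.hasDerivAt_log_dens j θ hp 0).tendsto_slope_zero
    simpa using this

/-- The likelihood-ratio formula: differentiation of an expectation in the parameter. -/
theorem Regular.hasDerivAt_integral (h : M.Regular α) (j : Fin k) (θ : Param k)
    {φ : (Fin n → ℝ) × S → ℝ} (hφ : Measurable φ) {K : ℝ} (hK : ∀ᵐ p ∂M.base, |φ p| ≤ K) :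
    HasDerivAt (fun t : ℝ => ∫ p, φ p ∂M.law (θ + t • EuclideanSpace.single j (1 : ℝ)))
      (∫ p, M.score j θ p * φ p ∂M.law θ) 0 := by
  obtain ⟨C, hC0, hC⟩ := h.exists_abs_score_le j
  simp only [integral_law]
  have hint : Integrable (fun p => M.dens θ p * φ p) M.base :=
    (M.integrable_dens θ).mul_bdd hφ.aestronglyMeasurable (by simpa using hK)
  -- For `|t| ≤ 1` the density is at most `exp C` times its value at `θ`; the other two factors of
  -- the majorant bound the score and `φ`.
  have key := hasDerivAt_integral_of_dominated_loc_of_deriv_le (𝕜 := ℝ) (μ := M.base)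
    (F := fun t p => M.dens (θ + t • EuclideanSpace.single j (1 : ℝ)) p * φ p)
    (F' := fun t p => M.dens (θ + t • EuclideanSpace.single j (1 : ℝ)) p *
      M.score j (θ + t • EuclideanSpace.single j (1 : ℝ)) p * φ p)
    (bound := fun p => Real.exp C * M.dens θ p * C * K)
    (Metric.ball_mem_nhds (0 : ℝ) one_pos)
    (Eventually.of_forall fun t => ((M.measurable_dens _).mul hφ).aestronglyMeasurable)
    (by simpa using hint)
    (((M.measurable_dens _).aemeasurable.mul (h.aemeasurable_score j _)).mul
      hφ.aemeasurable).aestronglyMeasurable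
    (by
      filter_upwards [M.ae_base_mem_box, hK] with p hp hKp t ht
      have ht' : |t| ≤ 1 := by simpa using (Metric.mem_ball.1 ht).le
      have hd : M.dens (θ + t • EuclideanSpace.single j (1 : ℝ)) p ≤
          Real.exp C * M.dens θ p :=
        (h.dens_le hC θ hp t).trans (mul_le_mul_of_nonneg_right
          (Real.exp_le_exp.2 (mul_le_of_le_one_right hC0 ht')) (M.dens_nonneg _ _))
      have hr : 0 ≤ Real.exp C * M.dens θ p :=
        mul_nonneg (Real.exp_pos _).le (M.dens_nonneg _ _)
      rw [norm_mul, norm_mul, Real.norm_of_nonneg (M.dens_nonneg _ _), Real.norm_eq_abs,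
        Real.norm_eq_abs]
      exact mul_le_mul (mul_le_mul hd (hC _ p hp) (abs_nonneg _) hr) hKp (abs_nonneg _)
        (mul_nonneg hr hC0))
    ((((M.integrable_dens θ).const_mul _).mul_const _).mul_const _)
    (by
      filter_upwards [M.ae_base_mem_box] with p hp t _
      exact (h.hasDerivAt_dens j θ hp t).mul_const _)
  simpa [mul_assoc] using key.2

/-- The likelihood-ratio formula for the gradient of the CVaR. -/
theorem Regular.pderiv_Phi (h : M.Regular α) (hα : α ∈ Set.Ioo (0 : ℝ) 1) (j : Fin k)
    (θ : Param k) :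
    pderiv (M.Phi α) j θ =
      -(α⁻¹ * ∫ p, M.score j θ p * max (M.nu α θ - M.R p) 0 ∂M.law θ) := by
  obtain ⟨C, hC0, hC⟩ := M.exists_abs_R_le
  set ν := M.nu α θ with hν
  have hint : ∀ θ' : Param k, ∫ z, max (ν - z) 0 ∂M.rewardLaw θ' =
      ∫ p, max (ν - M.R p) 0 ∂M.law θ' := fun θ' =>
    integral_map M.measurable_R.aemeasurable
      ((measurable_const.sub measurable_id).max measurable_const).aestronglyMeasurable
  have hd := h.hasDerivAt_integral j θ (φ := fun p => max (ν - M.R p) 0) (K := |ν| + C)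
    ((measurable_const.sub M.measurable_R).max measurable_const) (by
      filter_upwards [hC] with p hp
      rw [abs_of_nonneg (le_max_right _ _)]
      refine max_le ?_ (by positivity)
      linarith [le_abs_self ν, neg_abs_le (M.R p)])
  have hΦ : HasDerivAt (fun t : ℝ => M.Phi α (θ + t • EuclideanSpace.single j (1 : ℝ)))
      (pderiv (M.Phi α) j θ) 0 := (h.Phi_partial θ j).hasLineDerivAt
  have hdiff := hΦ.sub ((hd.const_mul α⁻¹).const_sub ν)
  -- Envelope step: `ν` is optimal at `t = 0` and merely admissible for other `t`, so the gap is
  -- nonnegative and vanishes at 0.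
  have hmin : IsLocalMin ((fun t : ℝ => M.Phi α (θ + t • EuclideanSpace.single j (1 : ℝ))) -
      fun t : ℝ => ν - α⁻¹ * ∫ p, max (ν - M.R p) 0
        ∂M.law (θ + t • EuclideanSpace.single j (1 : ℝ))) 0 := by
    refine Eventually.of_forall fun t => ?_
    have h0 := VaR_sub_eq_CVaR hα.1 (M.integrable_rewardLaw θ)
      (cdf_VaR (h.continuous_cdf θ) hα)
    have h1 := sub_le_CVaR hα.1
      (M.integrable_rewardLaw (θ + t • EuclideanSpace.single j (1 : ℝ)))
      (cdf_VaR (h.continuous_cdf _) hα) ν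
    rw [hint] at h1
    change ν - α⁻¹ * ∫ z, max (ν - z) 0 ∂M.rewardLaw θ = M.Phi α θ at h0
    rw [hint] at h0
    simp only [Pi.sub_apply, zero_smul, add_zero]
    rw [← h0, sub_self]
    exact sub_nonneg.2 h1
  linarith [hmin.hasDerivAt_eq_zero hdiff]

end Regular

end Model

end GCVaR

end

/-! ### The estimator: dependence on the level, unbiasedness and bias rate. -/

noncomputable section

namespace GCVaR

namespace Model

variable {n k : ℕ} {S : Type*} (M : Model n k S)

/-- The estimator with the level `c` in place of the empirical VaR. -/
def fixedLevelEstimator (α : ℝ) (j : Fin k) (θ : Param k) (c : ℝ) {N : ℕ}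
    (s : Fin N → (Fin n → ℝ) × S) : ℝ :=
  -(α⁻¹ * ((N : ℝ)⁻¹ * ∑ i, M.score j θ (s i) * max (c - M.R (s i)) 0))

/-- The product of `R - ν̃` with the indicator of `R ≤ ν̃` is `-(ν̃ - R)⁺`. This removes the jump
and leaves an expression continuous in the level. -/
theorem estimator_eq (α : ℝ) (j : Fin k) (θ : Param k) {N : ℕ} (s : Fin N → (Fin n → ℝ) × S) :
    M.estimator α j θ s = M.fixedLevelEstimator α j θ (M.empiricalVaR α s) s := by
  have h : ∀ i, M.score j θ (s i) * (M.R (s i) - M.empiricalVaR α s) *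
      (if M.R (s i) ≤ M.empiricalVaR α s then 1 else 0) =
      -(M.score j θ (s i) * max (M.empiricalVaR α s - M.R (s i)) 0) := by
    intro i
    split_ifs with hi
    · rw [max_eq_left (sub_nonneg.2 hi)]
      ring
    · rw [max_eq_right (sub_nonpos.2 (not_le.1 hi).le)]
      ring
  simp only [estimator, fixedLevelEstimator, h, Finset.sum_neg_distrib, one_div, mul_inv]
  ring

/-- Each `(c - R)⁺` is 1-Lipschitz in `c`, and the score weights are at most `C`. This reduces the
bias to the error of the empirical VaR. -/
theorem abs_fixedLevelEstimator_sub_le {α : ℝ} (hα : 0 < α) {j : Fin k} {θ : Param k} {C : ℝ}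
    {N : ℕ} {s : Fin N → (Fin n → ℝ) × S} (hN : 0 < N)
    (hC : ∀ i, |M.score j θ (s i)| ≤ C) (c d : ℝ) :
    |M.fixedLevelEstimator α j θ c s - M.fixedLevelEstimator α j θ d s| ≤
      α⁻¹ * C * |c - d| := by
  have hN' : (0 : ℝ) < N := by exact_mod_cast hN
  have h : M.fixedLevelEstimator α j θ c s - M.fixedLevelEstimator α j θ d s =
      -(α⁻¹ * ((N : ℝ)⁻¹ * ∑ i, M.score j θ (s i) *
        (max (c - M.R (s i)) 0 - max (d - M.R (s i)) 0))) := by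
    simp only [fixedLevelEstimator, mul_sub, Finset.sum_sub_distrib]
    ring
  have hsum : |∑ i, M.score j θ (s i) * (max (c - M.R (s i)) 0 - max (d - M.R (s i)) 0)| ≤
      N * (C * |c - d|) := by
    refine (Finset.abs_sum_le_sum_abs _ _).trans ?_
    refine (Finset.sum_le_card_nsmul _ _ (C * |c - d|) fun i _ => ?_).trans_eq (by simp)
    rw [abs_mul]
    refine mul_le_mul (hC i) ?_ (abs_nonneg _) ((abs_nonneg _).trans (hC i))
    simpa using abs_max_sub_max_le_abs (c - M.R (s i)) (d - M.R (s i)) 0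
  rw [h, abs_neg, abs_mul, abs_mul, abs_of_pos (inv_pos.2 hα), abs_of_pos (inv_pos.2 hN'),
    mul_assoc]
  refine mul_le_mul_of_nonneg_left ?_ (inv_pos.2 hα).le
  rwa [← div_eq_inv_mul, div_le_iff₀' hN']

variable [Countable S] [MeasurableSpace S] [DiscreteMeasurableSpace S]
variable {M} {α : ℝ} {Ω : Type*} [MeasurableSpace Ω] {P : Measure Ω}
  {Z : ℕ → Ω → (Fin n → ℝ) × S} {θ : Param k}

theorem Regular.aemeasurable_fixedLevelEstimator (h : M.Regular α) (j : Fin k)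
    (hlaw : ∀ i, HasLaw (Z i) (M.law θ) P) (N : ℕ) {c : Ω → ℝ} (hc : AEMeasurable c P) :
    AEMeasurable (fun ω => M.fixedLevelEstimator α j θ (c ω) fun i : Fin N => Z i ω) P := by
  refine AEMeasurable.neg (AEMeasurable.const_mul (AEMeasurable.const_mul ?_ _) _)
  refine Finset.aemeasurable_fun_sum _ fun i _ => ?_
  have hs : AEMeasurable (M.score j θ) (P.map (Z i)) := by
    rw [(hlaw i).map_eq]
    exact (h.aemeasurable_score j θ).mono_ac (M.law_absolutelyContinuous θ)
  exact (hs.comp_aemeasurable (hlaw i).aemeasurable).mul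
    ((hc.sub (M.measurable_R.comp_aemeasurable (hlaw i).aemeasurable)).max aemeasurable_const)

theorem aemeasurable_empiricalVaR (hα : α ∈ Set.Ioo (0 : ℝ) 1)
    (hlaw : ∀ i, HasLaw (Z i) (M.law θ) P) (N : ℕ) :
    AEMeasurable (fun ω => M.empiricalVaR α fun i : Fin N => Z i ω) P :=
  (measurable_quantile_empirical hα).comp_aemeasurable
    (aemeasurable_pi_lambda _ fun i => M.measurable_R.comp_aemeasurable (hlaw i).aemeasurable)

/-- The estimator at the exact VaR is unbiased. -/
theorem Regular.integral_fixedLevelEstimator (h : M.Regular α) (hα : α ∈ Set.Ioo (0 : ℝ) 1)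
    (j : Fin k) (hlaw : ∀ i, HasLaw (Z i) (M.law θ) P) {N : ℕ} (hN : 0 < N) :
    Integrable (fun ω => M.fixedLevelEstimator α j θ (M.nu α θ) fun i : Fin N => Z i ω) P ∧
    ∫ ω, M.fixedLevelEstimator α j θ (M.nu α θ) (fun i : Fin N => Z i ω) ∂P =
      pderiv (M.Phi α) j θ := by
  have hN' : (N : ℝ) ≠ 0 := by positivity
  obtain ⟨A, hA0, hA⟩ := h.exists_abs_score_le j
  obtain ⟨C, -, hC⟩ := M.exists_abs_R_le
  set φ : (Fin n → ℝ) × S → ℝ := fun p => M.score j θ p * max (M.nu α θ - M.R p) 0 with hφ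
  have hm : AEMeasurable φ (M.law θ) :=
    ((h.aemeasurable_score j θ).mul ((measurable_const.sub M.measurable_R).max
      measurable_const).aemeasurable).mono_ac (M.law_absolutelyContinuous θ)
  have hφi : Integrable φ (M.law θ) := by
    refine Integrable.of_bound hm.aestronglyMeasurable (A * (|M.nu α θ| + |C|))
      ((M.law_absolutelyContinuous θ).ae_le ?_)
    filter_upwards [M.ae_base_mem_box, hC] with p hp hpC
    rw [Real.norm_eq_abs, abs_mul]
    refine mul_le_mul (hA θ p hp) ?_ (abs_nonneg _) hA0
    rw [abs_of_nonneg (le_max_right _ _)]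
    refine max_le ?_ (by positivity)
    linarith [le_abs_self (M.nu α θ), neg_abs_le (M.R p), le_abs_self C]
  have hint : ∀ i, Integrable (fun ω => φ (Z i ω)) P := fun i => by
    have : Integrable φ (P.map (Z i)) := by rwa [(hlaw i).map_eq]
    exact this.comp_aemeasurable (hlaw i).aemeasurable
  have hval : ∀ i, ∫ ω, φ (Z i ω) ∂P = ∫ p, φ p ∂M.law θ := fun i =>
    (hlaw i).integral_comp hm.aestronglyMeasurable
  constructor
  · exact (((integrable_finsetSum _ fun i _ => hint _).const_mul _).const_mul _).neg
  · rw [h.pderiv_Phi hα]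
    simp only [fixedLevelEstimator]
    rw [integral_neg, integral_const_mul, integral_const_mul,
      integral_finsetSum _ fun i _ => hint _]
    rw [Finset.sum_congr rfl fun i _ => hval _]
    simp only [Finset.sum_const, Finset.card_univ, Fintype.card_fin, nsmul_eq_mul,
      inv_mul_cancel_left₀ hN', hφ]

/-- The empirical VaR converges to the VaR in mean at the rate `N^{-1/2}`. -/
theorem Regular.exists_integral_abs_empiricalVaR_sub_le [IsProbabilityMeasure P]
    (h : M.Regular α) (hα : α ∈ Set.Ioo (0 : ℝ) 1) {f : ℝ → ℝ} (hf : M.IsRewardDensity θ f)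
    (hfc : ContinuousAt f (M.nu α θ)) (hfpos : 0 < f (M.nu α θ)) (hindep : iIndepFun Z P)
    (hlaw : ∀ i, HasLaw (Z i) (M.law θ) P) :
    ∃ K : ℝ, ∀ N : ℕ, 0 < N →
      Integrable (fun ω => |M.empiricalVaR α (fun i : Fin N => Z i ω) - M.nu α θ|) P ∧
      ∫ ω, |M.empiricalVaR α (fun i : Fin N => Z i ω) - M.nu α θ| ∂P ≤
        K * (N : ℝ) ^ (-(1 / 2) : ℝ) := by
  obtain ⟨C, -, hC⟩ := M.exists_abs_R_le
  -- Enlarging the bound on `R` to cover the VaR avoids proving that the VaR lies within it.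
  set D := max C |M.nu α θ| with hD
  obtain ⟨c, hc, hgrow⟩ := exists_linear_growth_cdf hf.2.2 hfc hfpos (2 * D)
  have hcdf : cdf (M.rewardLaw θ) (M.nu α θ) = α := cdf_VaR (h.continuous_cdf θ) hα
  rw [hcdf] at hgrow
  have hR : HasLaw M.R (M.rewardLaw θ) (M.law θ) := ⟨M.measurable_R.aemeasurable, rfl⟩
  have hbd : ∀ i, ∀ᵐ ω ∂P, |M.R (Z i ω)| ≤ D := fun i => by
    have h1 : ∀ᵐ p ∂P.map (Z i), |M.R p| ≤ D := by
      rw [(hlaw i).map_eq]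
      exact (M.law_absolutelyContinuous θ).ae_le
        (hC.mono fun p hp => hp.trans (le_max_left _ _))
    exact ae_of_ae_map (hlaw i).aemeasurable h1
  refine ⟨√(Real.pi / (2 * c ^ 2)), fun N hN => ?_⟩
  obtain ⟨hi, hle⟩ := integral_abs_quantile_empirical_sub_le hα
    (hindep.comp (fun _ => M.R) fun _ => M.measurable_R) (fun i => hR.comp (hlaw i)) hbd
    (le_max_right _ _) hc hgrow hN
  refine ⟨hi, hle.trans_eq ?_⟩
  rw [Real.rpow_neg N.cast_nonneg, ← Real.sqrt_eq_rpow, ← Real.sqrt_inv,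
    ← Real.sqrt_mul (by positivity)]
  congr 1
  field_simp

end Model

end GCVaR

end

theorem theorem2 {n k : ℕ} {S : Type*} [Countable S] [MeasurableSpace S]
    [DiscreteMeasurableSpace S] (M : GCVaR.Model n k S) (α : ℝ) (hα : α ∈ Set.Ioo (0 : ℝ) 1)
    (j : Fin k) (hreg : M.Regular α) (hlevel : M.NiceLevelSets α) (hsmooth : M.SmoothAtVaR α j)
    (θ : GCVaR.Param k) {Ω : Type*} [MeasurableSpace Ω] (P : Measure Ω) [IsProbabilityMeasure P]
    (Z : ℕ → Ω → (Fin n → ℝ) × S) (hindep : iIndepFun Z P)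
    (hlaw : ∀ i, HasLaw (Z i) (M.law θ) P) :
    (∀ N : ℕ, Integrable (fun ω => M.estimator α j θ fun i : Fin N => Z i ω) P) ∧
    (fun N : ℕ => (∫ ω, M.estimator α j θ (fun i : Fin N => Z i ω) ∂P) -
        GCVaR.pderiv (M.Phi α) j θ)
      =O[atTop] fun N : ℕ => (N : ℝ) ^ (-(1 / 2) : ℝ) := by
  obtain ⟨⟨f, hf, hfc, hfpos⟩, -⟩ := hsmooth θ
  obtain ⟨A, hA0, hA⟩ := hreg.exists_abs_score_le j
  obtain ⟨K, hK⟩ :=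
    hreg.exists_integral_abs_empiricalVaR_sub_le hα hf hfc hfpos hindep hlaw
  have hα' : 0 < α⁻¹ := inv_pos.2 hα.1
  have hbox : ∀ᵐ ω ∂P, ∀ i, (Z i ω).1 ∈ M.box := ae_all_iff.2 fun i => by
    have h1 : ∀ᵐ p ∂P.map (Z i), p.1 ∈ M.box := by
      rw [(hlaw i).map_eq]
      exact (M.law_absolutelyContinuous θ).ae_le M.ae_base_mem_box
    exact ae_of_ae_map (hlaw i).aemeasurable h1
  have hdiff : ∀ N : ℕ, 0 < N → ∀ᵐ ω ∂P,
      ‖M.estimator α j θ (fun i : Fin N => Z i ω) -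
        M.fixedLevelEstimator α j θ (M.nu α θ) (fun i : Fin N => Z i ω)‖ ≤
      α⁻¹ * A * |M.empiricalVaR α (fun i : Fin N => Z i ω) - M.nu α θ| := by
    intro N hN
    filter_upwards [hbox] with ω hω
    rw [M.estimator_eq]
    exact M.abs_fixedLevelEstimator_sub_le hα.1 hN (fun i => hA θ _ (hω i)) _ _
  have hint : ∀ N : ℕ, 0 < N → Integrable (fun ω => M.estimator α j θ (fun i : Fin N => Z i ω) -
        M.fixedLevelEstimator α j θ (M.nu α θ) (fun i : Fin N => Z i ω)) P := by
    intro N hN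
    refine Integrable.mono' ((hK N hN).1.const_mul (α⁻¹ * A)) ?_ (hdiff N hN)
    simp only [M.estimator_eq]
    exact ((hreg.aemeasurable_fixedLevelEstimator j hlaw N
      (GCVaR.Model.aemeasurable_empiricalVaR hα hlaw N)).sub
      (hreg.aemeasurable_fixedLevelEstimator j hlaw N aemeasurable_const)).aestronglyMeasurable
  -- The estimator is the integrable difference plus the integrable unbiased version.
  have hest : ∀ N : ℕ, 0 < N → Integrable (fun ω => M.estimator α j θ fun i : Fin N => Z i ω) P :=
    fun N hN => by
      simpa [Pi.add_def] using (hint N hN).add (hreg.integral_fixedLevelEstimator hα j hlaw hN).1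
  refine ⟨fun N => ?_, ?_⟩
  · rcases N.eq_zero_or_pos with rfl | hN
    -- The empty sample gives an empty sum, so the estimator is 0.
    · simp [GCVaR.Model.estimator]
    · exact hest N hN
  · refine IsBigO.of_bound (α⁻¹ * A * K) ?_
    filter_upwards [eventually_gt_atTop 0] with N hN
    obtain ⟨hi, hval⟩ := hreg.integral_fixedLevelEstimator hα j hlaw hN
    -- By unbiasedness at the true VaR, the bias is the mean effect of replacing the level.
    rw [← hval, ← integral_sub (hest N hN) hi, Real.norm_of_nonneg
      (Real.rpow_nonneg N.cast_nonneg _)]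
    calc _ ≤ ∫ ω, α⁻¹ * A * |M.empiricalVaR α (fun i : Fin N => Z i ω) - M.nu α θ| ∂P :=
          norm_integral_le_of_norm_le ((hK N hN).1.const_mul _) (hdiff N hN)
      _ = α⁻¹ * A * ∫ ω, |M.empiricalVaR α (fun i : Fin N => Z i ω) - M.nu α θ| ∂P :=
          integral_const_mul _ _
      _ ≤ α⁻¹ * A * (K * (N : ℝ) ^ (-(1 / 2) : ℝ)) :=
          mul_le_mul_of_nonneg_left (hK N hN).2 (mul_nonneg hα'.le hA0)
      _ = _ := by ring
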